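/- Let $k=\mathbb F_q$ be a finite field with $q$ elements. A Kronecker module is a finite-dimensional representation $M=(V_1,V_2;\alpha,\beta)$ of the Kronecker quiver $1\leftleftarrows 2$ over $k$, i.e. two finite-dimensional $k$-vector spaces with two $k$-linear maps $\alpha,\beta:V_2\to V_1$; its dimension vector is $(\dim V_1,\dim V_2)$. For $a,b\in\mathbb Z$ let $Gr_{(a,b)}(M)$ be the set of submodules of $M$ of dimension vector $(a,b)$. For $l,c\in\mathbb Z$ the Gaussian coefficient is $G^l_c(q)=\frac{(q^c-1)(q^{c-1}-1)\cdots(q^{c-l+1}-1)}{(q^l-1)(q^{l-1}-1)\cdots(q-1)}$ if $l>0$, $G^0_c(q)=1$, and $G^l_c(q)=0$ if $l<0$. Theorem 4.3. Let $n\ge 0$ be an integer and let $I_n$ be the (preinjective) indecomposable Kronecker module over $k$ of dimension vector $(n,n+1)$, which is unique up to isomorphism. Then for all $a,b\in\mathbb Z$ $$|Gr_{(a,b)}(I_n)|=\begin{cases}0 & \text{if } a>n \text{ or } b>n+1,\\ 1 & \text{if } (a,b)=(n,n+1),\\ G^{a-b}_{n-b}(q)\,G^{b}_{a+1}(q) &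 \text{otherwise.}\end{cases}$$ -/

import Mathlib

/-- A finite-dimensional Kronecker module over the field `k`: a finite-dimensional representation
of the Kronecker quiver, which has two vertices `1`, `2` and two arrows `α`, `β` from `2` to `1`.
(So the simple module at vertex `1` is projective, and the simple module at vertex `2` is
injective.) -/
structure KroneckerModule.{u, v} (k : Type u) [Field k] where
  /-- the space at the vertex `1` -/
  V₁ : Type v
  /-- the space at the vertex `2` -/
  V₂ : Type v
  [addCommGroup₁ : AddCommGroup V₁]
  [addCommGroup₂ : AddCommGroup V₂]
  [module₁ : Module k V₁]
  [module₂ : Module k V₂]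
  [finiteDimensional₁ : FiniteDimensional k V₁]
  [finiteDimensional₂ : FiniteDimensional k V₂]
  /-- the first arrow -/
  α : V₂ →ₗ[k] V₁
  /-- the second arrow -/
  β : V₂ →ₗ[k] V₁

namespace KroneckerModule

attribute [instance] addCommGroup₁ addCommGroup₂ module₁ module₂
  finiteDimensional₁ finiteDimensional₂

variable {k : Type*} [Field k]

/-- `M` has dimension vector `(m, n)`: dimension `m` at the vertex `1`, `n` at the vertex `2`. -/
def HasDimVector (M : KroneckerModule k) (m n : ℤ) : Prop :=
  (Module.finrank k M.V₁ : ℤ) = m ∧ (Module.finrank k M.V₂ : ℤ) = n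

/-- A submodule of a Kronecker module: a pair of subspaces stable under both arrows. -/
structure Sub (M : KroneckerModule k) where
  /-- the subspace at the vertex `1` -/
  U₁ : Submodule k M.V₁
  /-- the subspace at the vertex `2` -/
  U₂ : Submodule k M.V₂
  α_mem : ∀ x ∈ U₂, M.α x ∈ U₁
  β_mem : ∀ x ∈ U₂, M.β x ∈ U₁

/-- A submodule, as a Kronecker module. -/
def Sub.toModule {M : KroneckerModule k} (N : M.Sub) : KroneckerModule k where
  V₁ := N.U₁
  V₂ := N.U₂
  α := M.α.restrict N.α_mem
  β := M.β.restrict N.β_mem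

/-- The zero module. -/
def IsZero (M : KroneckerModule k) : Prop := Subsingleton M.V₁ ∧ Subsingleton M.V₂

/-- `M` is the (internal) direct sum of its submodules `N` and `N'`. -/
def IsDirectSum (M : KroneckerModule k) (N N' : M.Sub) : Prop :=
  IsCompl N.U₁ N'.U₁ ∧ IsCompl N.U₂ N'.U₂

/-- `M` is indecomposable: it is nonzero, and it is not the direct sum of two nonzero
submodules. -/
def Indecomposable (M : KroneckerModule k) : Prop :=
  ¬ M.IsZero ∧
    ∀ N N' : M.Sub, M.IsDirectSum N N' → N.toModule.IsZero ∨ N'.toModule.IsZero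

/-- The set of submodules of `M` of dimension vector `(a, b)` (the quiver Grassmannian). -/
def Gr (M : KroneckerModule k) (a b : ℤ) : Set M.Sub :=
  {N | N.toModule.HasDimVector a b}

end KroneckerModule

/-- The Gaussian coefficient with upper index `l`, lower index `a` (both arbitrary integers):
`(q ^ a - 1) ⋯ (q ^ (a - l + 1) - 1) / ((q ^ l - 1) ⋯ (q - 1))` for `l > 0`,
`1` for `l = 0`, and `0` for `l < 0`. -/
def gaussCoeff (l a : ℤ) (q : ℚ) : ℚ :=
  if l < 0 then 0
  else (∏ i ∈ Finset.range l.toNat, (q ^ (a - i) - 1)) /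
    ∏ i ∈ Finset.range l.toNat, (q ^ (i + 1) - 1)

/-!
The proof is an induction on `n` by reflection, which avoids the classification of Kronecker
modules and any explicit model of `I`.

If `M = (V₁, V₂; α, β)` is indecomposable with `V₁ ≠ 0`, then `V₂ → V₁ × V₁` is injective
(`Indecomposable.arrows_injective`), and the module `M.reflect = (coker (V₂ → V₁ × V₁), V₁)` is
again indecomposable (`Indecomposable.reflect`). Dimension vector `(m + 1, m + 2)` becomes
`(m, m + 1)`. Both modules have subspaces of `V₁` as components of their submodules: a submodule
of `M` is a subspace `U` of `V₁` together with a subspace of `M.cogen U = α⁻¹ U ∩ β⁻¹ U`, and a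
submodule of `M.reflect` is such a `U` together with a subspace containing the subspace
`M.reflect.gen U` that `U` generates in the cokernel. Moreover
`dim (M.cogen U) + dim (M.reflect.gen U) = 2 dim U` (`finrank_cogen_add_finrank_gen_reflect`).

Hence, writing `e U` for the codimension of `M.reflect.gen U`, the numbers of submodules of
`M.reflect` are the sums `∑ U, [e U choose f]_q` over the `U` of a given dimension. As the functions
`[· choose f]_q` with `f ≤ m` span all functions on `{0, …, m}` (`exists_eq_sum_qBinom`), these
sums determine the distribution of `e`, which is found explicitly in `sum_comp_eq_of_sum_qBinom`;
summing over it the number `[dim (M.cogen U) choose b]_q` of choices of the other component gives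
the count for `M` (`Indecomposable.natCard_sub`). Both computations reduce to the `q`-Vandermonde
identity `sum_qBinom_mul_qBinom`.

In dimension vector `(a, b)` with `b = n + 1`, only the whole module can occur, because the images
of `α` and `β` span `V₁` (`Indecomposable.gen_top`).
-/

/-! ### Gaussian binomial coefficients -/

/-- The Gaussian binomial coefficient `[n choose k]` at `q`, defined by the `q`-Pascal recursion,
so that it vanishes for `k > n`. -/
def qBinom (q : ℚ) : ℕ → ℕ → ℚ
  | _, 0 => 1
  | 0, _ + 1 => 0
  | n + 1, k + 1 => qBinom q n k + q ^ (k + 1) * qBinom q n (k + 1)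

/-- The (unnormalised) `q`-factorial `(q - 1) (q ^ 2 - 1) ⋯ (q ^ n - 1)`. -/
def qFact (q : ℚ) (n : ℕ) : ℚ := ∏ i ∈ Finset.range n, (q ^ (i + 1) - 1)

section qBinom

variable (q : ℚ)

@[simp] lemma qBinom_zero_right (n : ℕ) : qBinom q n 0 = 1 := by cases n <;> rfl

lemma qBinom_succ_succ (n k : ℕ) :
    qBinom q (n + 1) (k + 1) = qBinom q n k + q ^ (k + 1) * qBinom q n (k + 1) := rfl

lemma qBinom_eq_zero {n k : ℕ} (h : n < k) : qBinom q n k = 0 := by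
  induction n generalizing k with
  | zero => obtain ⟨k, rfl⟩ := Nat.exists_eq_succ_of_ne_zero h.ne'; rfl
  | succ n ih =>
    obtain ⟨k, rfl⟩ := Nat.exists_eq_succ_of_ne_zero (Nat.ne_zero_of_lt h)
    rw [Nat.succ_eq_add_one, qBinom_succ_succ, ih (by omega), ih (by omega)]
    simp

@[simp] lemma qBinom_self (n : ℕ) : qBinom q n n = 1 := by
  induction n with
  | zero => rfl
  | succ n ih => rw [qBinom_succ_succ, ih, qBinom_eq_zero q (Nat.lt_succ_self n)]; simp

lemma qFact_succ (n : ℕ) : qFact q (n + 1) = qFact q n * (q ^ (n + 1) - 1) :=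
  Finset.prod_range_succ _ _

lemma qBinom_mul_qFact (k l : ℕ) :
    qBinom q (k + l) k * (qFact q k * qFact q l) = qFact q (k + l) := by
  induction h : k + l generalizing k l with
  | zero =>
    obtain ⟨rfl, rfl⟩ : k = 0 ∧ l = 0 := by omega
    simp [qFact]
  | succ n ih =>
    rcases k with _ | k
    · obtain rfl : l = n + 1 := by omega
      simp [qFact]
    rcases l with _ | l
    · obtain rfl : k = n := by omega
      simp [qFact]
    have h1 := ih k (l + 1) (by omega)
    have h2 := ih (k + 1) l (by omega)
    obtain rfl : n = k + 1 + l := by omega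
    rw [qBinom_succ_succ, qFact_succ q (k + 1 + l)]
    rw [qFact_succ] at h1 h2 ⊢
    rw [qFact_succ q l]
    linear_combination (q ^ (k + 1) - 1) * h1 + q ^ (k + 1) * (q ^ (l + 1) - 1) * h2

/-- The `q`-Vandermonde identity, in the form
`∑ j, q ^ (j (j + d)) [r choose j] [m choose j + d] = [r + m choose r + d]`. -/
lemma sum_qBinom_mul_qBinom (r m d : ℕ) :
    ∑ j ∈ Finset.range (r + 1), q ^ (j * (j + d)) * qBinom q r j * qBinom q m (j + d) =
      qBinom q (r + m) (r + d) := by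
  induction r generalizing m d with
  | zero => simp
  | succ r ih =>
    have hsplit : ∀ j, q ^ ((j + 1) * (j + 1 + d)) * qBinom q (r + 1) (j + 1) *
        qBinom q m (j + 1 + d) =
        q ^ ((j + 1) * (j + 1 + d)) * qBinom q r j * qBinom q m (j + 1 + d) +
        q ^ ((j + 1) * (j + 1 + (d + 1))) * qBinom q r (j + 1) * qBinom q m (j + 1 + d) := by
      intro j; rw [qBinom_succ_succ]; ring
    have hmerge : ∀ j, q ^ (j * (j + (d + 1))) * qBinom q r j * qBinom q (m + 1) (j + (d + 1)) =
        q ^ ((j + 1) * (j + 1 + d)) * qBinom q r j * qBinom q m (j + 1 + d) +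
        q ^ (j * (j + (d + 1))) * qBinom q r j * qBinom q m (j + d) := by
      intro j
      rw [← add_assoc j d 1, qBinom_succ_succ, add_right_comm j 1 d]; ring
    have hshift := Finset.sum_range_succ'
      (fun j => q ^ (j * (j + (d + 1))) * qBinom q r j * qBinom q m (j + d)) (r + 1)
    rw [Finset.sum_range_succ, qBinom_eq_zero q (Nat.lt_succ_self r)] at hshift
    rw [show r + 1 + m = r + (m + 1) by ring, show r + 1 + d = r + (d + 1) by ring,
      ← ih (m + 1) (d + 1), Finset.sum_range_succ']
    simp only [hsplit, hmerge, Finset.sum_add_distrib]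
    simp only [qBinom_zero_right, mul_zero, zero_mul, add_zero] at hshift ⊢
    rw [hshift, add_assoc]

/-- Every function on `{0, …, m}` is a linear combination of the functions `e ↦ [e choose f]`
with `f ≤ m` (Newton interpolation). -/
lemma exists_eq_sum_qBinom (g : ℕ → ℚ) (m : ℕ) :
    ∃ c : ℕ → ℚ, ∀ e ≤ m, g e = ∑ f ∈ Finset.range (m + 1), c f * qBinom q e f := by
  induction m with
  | zero => exact ⟨fun _ => g 0, by simp⟩
  | succ m ih =>
    obtain ⟨c, hc⟩ := ih
    refine ⟨Function.update c (m + 1)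
      (g (m + 1) - ∑ f ∈ Finset.range (m + 1), c f * qBinom q (m + 1) f), fun e he => ?_⟩
    have h : ∀ e, ∑ f ∈ Finset.range (m + 1), Function.update c (m + 1)
        (g (m + 1) - ∑ f ∈ Finset.range (m + 1), c f * qBinom q (m + 1) f) f * qBinom q e f =
        ∑ f ∈ Finset.range (m + 1), c f * qBinom q e f := fun e =>
      Finset.sum_congr rfl fun f hf => by
        rw [Function.update_of_ne (by have := Finset.mem_range.1 hf; omega)]
    rw [Finset.sum_range_succ, h, Function.update_self]
    rcases he.eq_or_lt with rfl | he
    · simp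
    · rw [qBinom_eq_zero q he, mul_zero, add_zero, hc e (by omega)]

variable {q}

lemma qFact_ne_zero (hq : 1 < q) (n : ℕ) : qFact q n ≠ 0 :=
  Finset.prod_ne_zero_iff.2 fun i _ => (sub_pos.2 (one_lt_pow₀ hq i.succ_ne_zero)).ne'

lemma qBinom_add_eq_div (hq : 1 < q) (k l : ℕ) :
    qBinom q (k + l) k = qFact q (k + l) / (qFact q k * qFact q l) :=
  eq_div_of_mul_eq (mul_ne_zero (qFact_ne_zero hq _) (qFact_ne_zero hq _))
    (qBinom_mul_qFact q k l)

lemma qBinom_symm_add (hq : 1 < q) (k l : ℕ) : qBinom q (k + l) k = qBinom q (k + l) l := by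
  rw [qBinom_add_eq_div hq, add_comm k l, qBinom_add_eq_div hq, mul_comm]

/-- Trinomial revision: for `x + b ≤ N` both sides are the `q`-multinomial coefficient with parts
`x`, `b`, `N - x - b`, and otherwise both vanish. -/
lemma qBinom_mul_qBinom_sub (hq : 1 < q) (N x b : ℕ) :
    qBinom q N x * qBinom q (N - x) b = qBinom q N b * qBinom q (N - b) x := by
  by_cases h : x + b ≤ N
  · obtain ⟨c, rfl⟩ := Nat.exists_eq_add_of_le h
    have h1 := qBinom_add_eq_div hq x (b + c)
    have h2 := qBinom_add_eq_div hq b (x + c)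
    have h3 := qBinom_add_eq_div hq x c
    have h4 := qBinom_add_eq_div hq b c
    rw [show x + b + c - x = b + c by omega, show x + b + c - b = x + c by omega, h3, h4]
    rw [show x + (b + c) = x + b + c by ring] at h1
    rw [show b + (x + c) = x + b + c by ring] at h2
    rw [h1, h2]
    have := qFact_ne_zero hq
    field_simp [this x, this b, this c, this (b + c), this (x + c)]
  · have h0 : ∀ x b, N < x + b → qBinom q N x * qBinom q (N - x) b = 0 := fun x b h => by
      by_cases hx : x ≤ N
      · rw [qBinom_eq_zero q (show N - x < b by omega), mul_zero]
      · rw [qBinom_eq_zero q (not_le.1 hx), zero_mul]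
    rw [h0 x b (by omega), h0 b x (by omega)]

/-- The numerator of `gaussCoeff k (k + l)`, as a quotient of `q`-factorials. -/
lemma prod_zpow_sub_one_mul_qFact (k l : ℕ) :
    (∏ i ∈ Finset.range k, (q ^ (((k + l : ℕ) : ℤ) - i) - 1)) * qFact q l = qFact q (k + l) := by
  induction k generalizing l with
  | zero => simp
  | succ k ih =>
    have h := ih (l + 1)
    rw [Finset.prod_range_succ, show k + 1 + l = k + (l + 1) by ring, ← h, qFact_succ,
      show ((k + (l + 1) : ℕ) : ℤ) - k = ((l + 1 : ℕ) : ℤ) by push_cast; ring, zpow_natCast]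
    ring

lemma gaussCoeff_natCast (hq : 1 < q) (l a : ℕ) : gaussCoeff l a q = qBinom q a l := by
  rw [gaussCoeff, if_neg (by omega), Int.toNat_natCast]
  by_cases h : l ≤ a
  · obtain ⟨c, rfl⟩ := Nat.exists_eq_add_of_le h
    rw [qBinom_add_eq_div hq, ← prod_zpow_sub_one_mul_qFact l c, ← qFact,
      mul_div_mul_right _ _ (qFact_ne_zero hq c)]
  · rw [qBinom_eq_zero q (not_le.1 h), Finset.prod_eq_zero (Finset.mem_range.2 (not_le.1 h)),
      zero_div]
    simp

variable (q) in
/-- The number of independent `k`-tuples in dimension `k + l`, in terms of `q`-factorials. -/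
lemma prod_pow_sub_pow_mul_qFact (k l : ℕ) :
    (∏ i ∈ Finset.range k, (q ^ (k + l) - q ^ i)) * qFact q l =
      q ^ (∑ i ∈ Finset.range k, i) * qFact q (k + l) := by
  induction k generalizing l with
  | zero => simp
  | succ k ih =>
    have h := ih (l + 1)
    rw [qFact_succ] at h
    rw [Finset.prod_range_succ, Finset.sum_range_succ, show k + 1 + l = k + (l + 1) by ring,
      pow_add q (∑ i ∈ _, _), mul_right_comm _ _ (qFact q (k + (l + 1))), ← h]
    ring

end qBinom

/-! ### Counting subspaces over a finite field -/

section Count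

open Module

lemma finrank_map_add_finrank_ker_inf {k V W : Type*} [Field k] [AddCommGroup V] [Module k V]
    [FiniteDimensional k V] [AddCommGroup W] [Module k W] (f : V →ₗ[k] W) (P : Submodule k V) :
    finrank k (P.map f) + finrank k ↥(LinearMap.ker f ⊓ P) = finrank k P := by
  rw [← LinearMap.finrank_range_add_finrank_ker (f.domRestrict P), LinearMap.range_domRestrict,
    LinearMap.ker_domRestrict, ← Submodule.finrank_map_subtype_eq, Submodule.map_comap_subtype,
    inf_comm]

variable {k : Type*} [Field k] [Finite k] {V : Type*} [AddCommGroup V] [Module k V]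
  [FiniteDimensional k V]

/-- Every independent family of `d` vectors spans a subspace of dimension `d`, and the families
spanning a given subspace are its bases. -/
lemma natCard_linearIndependent_eq_mul (d : ℕ) :
    Nat.card {s : Fin d → V // LinearIndependent k s} =
      Nat.card {U : Submodule k V // finrank k U = d} *
        Nat.card {s : Fin d → (Fin d → k) // LinearIndependent k s} := by
  have : Finite V := Module.finite_of_finite k
  let F : {s : Fin d → V // LinearIndependent k s} → {U : Submodule k V // finrank k U = d} :=
    fun s => ⟨Submodule.span k (Set.range s.1), by rw [finrank_span_eq_card s.2, Fintype.card_fin]⟩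
  rw [Nat.card_congr (Equiv.sigmaFiberEquiv F).symm, ← Nat.card_prod]
  refine Nat.card_congr ((Equiv.sigmaCongrRight fun U => ?_).trans (Equiv.sigmaEquivProd _ _))
  let e : U.1 ≃ₗ[k] (Fin d → k) := LinearEquiv.ofFinrankEq _ _ (by rw [U.2]; simp)
  exact
    { toFun := fun s => ⟨fun i => e ⟨s.1.1 i, by
          have h : Submodule.span k (Set.range s.1.1) = U.1 := congrArg Subtype.val s.2
          rw [← h]; exact Submodule.subset_span ⟨i, rfl⟩⟩, by
          refine LinearIndependent.map' ?_ e.toLinearMap e.ker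
          exact LinearIndependent.of_comp U.1.subtype s.1.2⟩
      invFun := fun s =>
        have hs : LinearIndependent k fun i => (e.symm (s.1 i) : V) :=
          (s.2.map' e.symm.toLinearMap e.symm.ker).map' U.1.subtype (Submodule.ker_subtype _)
        ⟨⟨fun i => e.symm (s.1 i), hs⟩, Subtype.ext <| by
          refine Submodule.eq_of_le_of_finrank_eq (Submodule.span_le.2 ?_) ?_
          · rintro _ ⟨i, rfl⟩; exact (e.symm (s.1 i)).2
          · rw [finrank_span_eq_card hs, Fintype.card_fin, U.2]⟩
      left_inv := fun s => by ext; simp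
      right_inv := fun s => by ext; simp }

lemma natCard_linearIndependent_cast {d : ℕ} (hd : d ≤ finrank k V) :
    (Nat.card {s : Fin d → V // LinearIndependent k s} : ℚ) =
      ∏ i ∈ Finset.range d, ((Nat.card k : ℚ) ^ finrank k V - (Nat.card k : ℚ) ^ i) := by
  have : Finite V := Module.finite_of_finite k
  have := Fintype.ofFinite k
  rw [card_linearIndependent hd, ← Fin.prod_univ_eq_prod_range
    (fun i => (Nat.card k : ℚ) ^ finrank k V - (Nat.card k : ℚ) ^ i), Nat.cast_prod]
  refine Finset.prod_congr rfl fun i _ => ?_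
  rw [Nat.cast_sub (Nat.pow_le_pow_right Fintype.card_pos (by omega)), Nat.card_eq_fintype_card]
  push_cast
  rfl

variable (k) in
lemma one_lt_natCard_cast : (1 : ℚ) < Nat.card k := by
  exact_mod_cast Finite.one_lt_card (α := k)

variable (k V) in
theorem natCard_submodule_finrank_eq (d : ℕ) :
    (Nat.card {U : Submodule k V // finrank k U = d} : ℚ) =
      qBinom (Nat.card k) (finrank k V) d := by
  by_cases hd : d ≤ finrank k V
  · have h := congrArg (Nat.cast : ℕ → ℚ) (natCard_linearIndependent_eq_mul (k := k) (V := V) d)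
    rw [Nat.cast_mul, natCard_linearIndependent_cast hd,
      natCard_linearIndependent_cast (by simp), finrank_fin_fun] at h
    have hq := one_lt_natCard_cast k
    obtain ⟨c, hc⟩ := Nat.exists_eq_add_of_le hd
    have h1 := prod_pow_sub_pow_mul_qFact (Nat.card k : ℚ) d c
    have h2 := prod_pow_sub_pow_mul_qFact (Nat.card k : ℚ) d 0
    rw [hc] at h ⊢
    rw [qBinom_add_eq_div hq, eq_div_iff (mul_ne_zero (qFact_ne_zero hq _) (qFact_ne_zero hq _))]
    have hpos : (Nat.card k : ℚ) ^ (∑ i ∈ Finset.range d, i) ≠ 0 := by positivity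
    refine mul_left_cancel₀ hpos ?_
    simp only [add_zero, qFact, Finset.range_zero, Finset.prod_empty, mul_one] at h2
    rw [← h1, h, h2]
    unfold qFact
    ring
  · rw [qBinom_eq_zero _ (not_le.1 hd), Nat.cast_eq_zero]
    have : IsEmpty {U : Submodule k V // finrank k U = d} :=
      ⟨fun U => hd (U.2 ▸ Submodule.finrank_le U.1)⟩
    exact Nat.card_of_isEmpty

theorem natCard_submodule_le_finrank_eq (W : Submodule k V) (d : ℕ) :
    (Nat.card {U : Submodule k V // U ≤ W ∧ finrank k U = d} : ℚ) =
      qBinom (Nat.card k) (finrank k W) d := by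
  rw [← natCard_submodule_finrank_eq k W d, Nat.cast_inj]
  refine Nat.card_congr (Equiv.symm ?_)
  refine (Equiv.subtypeEquiv (Submodule.mapIic W).toEquiv
    (q := fun U : {U // U ≤ W} => finrank k U.1 = d) fun U => ?_).trans
    (Equiv.subtypeSubtypeEquivSubtypeInter (fun U : Submodule k V => U ≤ W)
      (fun U => finrank k U = d))
  rw [← Submodule.finrank_map_subtype_eq]; rfl

theorem natCard_le_submodule_finrank_eq (W : Submodule k V) {d : ℕ} (hd : d ≤ finrank k V) :
    (Nat.card {U : Submodule k V // W ≤ U ∧ finrank k U = d} : ℚ) =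
      qBinom (Nat.card k) (finrank k V - finrank k W) (finrank k V - d) := by
  have hV := Submodule.finrank_quotient_add_finrank W
  have hfin : ∀ U : Submodule k (V ⧸ W),
      finrank k (U.comap W.mkQ) = finrank k U + finrank k W := fun U => by
    rw [← finrank_map_add_finrank_ker_inf W.mkQ (U.comap W.mkQ), Submodule.ker_mkQ,
      Submodule.map_comap_eq_of_surjective W.mkQ_surjective,
      inf_eq_left.2 (Submodule.le_comap_mkQ W U)]
  have key : Nat.card {U : Submodule k V // W ≤ U ∧ finrank k U = d} =
      Nat.card {U : Submodule k (V ⧸ W) // finrank k U + finrank k W = d} := by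
    refine Nat.card_congr (Equiv.symm ?_)
    refine (Equiv.subtypeEquiv (Submodule.comapMkQRelIso W).toEquiv
      (q := fun U : {U // W ≤ U} => finrank k U.1 = d) fun U => ?_).trans
      (Equiv.subtypeSubtypeEquivSubtypeInter (fun U : Submodule k V => W ≤ U)
        (fun U => finrank k U = d))
    rw [← hfin]; rfl
  rw [key]
  by_cases h : finrank k W ≤ d
  · obtain ⟨c, rfl⟩ := Nat.exists_eq_add_of_le h
    simp only [add_comm (finrank k W) c, add_left_inj]
    rw [natCard_submodule_finrank_eq]
    obtain ⟨l, hl⟩ := Nat.exists_eq_add_of_le (show c ≤ finrank k (V ⧸ W) by omega)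
    rw [hl, show finrank k V - finrank k W = c + l by omega,
      show finrank k V - (c + finrank k W) = l by omega,
      qBinom_symm_add (one_lt_natCard_cast k)]
  · have : IsEmpty {U : Submodule k (V ⧸ W) // finrank k U + finrank k W = d} :=
      ⟨fun U => by have := U.2; omega⟩
    rw [Nat.card_of_isEmpty, qBinom_eq_zero _ (by have := W.finrank_le; omega), Nat.cast_zero]

end Count

/-! ### Reflecting a Kronecker module -/

namespace KroneckerModule

open Module

section Reflection

universe u v

variable {k : Type u} [Field k] (M : KroneckerModule.{u, v} k)

/-- The subspace at the vertex `1` generated by a subspace `U` at the vertex `2`: the smallest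
`U₁` such that `(U₁, U)` is a submodule. -/
def gen (U : Submodule k M.V₂) : Submodule k M.V₁ := U.map M.α ⊔ U.map M.β

/-- The subspace at the vertex `2` cogenerated by a subspace `U` at the vertex `1`: the largest
`U₂` such that `(U, U₂)` is a submodule. -/
def cogen (U : Submodule k M.V₁) : Submodule k M.V₂ := U.comap M.α ⊓ U.comap M.β

variable {M}

lemma gen_le_iff {U₁ : Submodule k M.V₁} {U₂ : Submodule k M.V₂} :
    M.gen U₂ ≤ U₁ ↔ (∀ x ∈ U₂, M.α x ∈ U₁) ∧ ∀ x ∈ U₂, M.β x ∈ U₁ := by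
  rw [gen, sup_le_iff, Submodule.map_le_iff_le_comap, Submodule.map_le_iff_le_comap]; rfl

lemma le_cogen_iff {U₁ : Submodule k M.V₁} {U₂ : Submodule k M.V₂} :
    U₂ ≤ M.cogen U₁ ↔ (∀ x ∈ U₂, M.α x ∈ U₁) ∧ ∀ x ∈ U₂, M.β x ∈ U₁ := by
  rw [cogen, le_inf_iff]; rfl

lemma Sub.isZero_toModule_iff (N : M.Sub) : N.toModule.IsZero ↔ N.U₁ = ⊥ ∧ N.U₂ = ⊥ := by
  rw [← Submodule.subsingleton_iff_eq_bot, ← Submodule.subsingleton_iff_eq_bot]; rfl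

variable (M) in
/-- The map `V₂ → V₁ × V₁` whose components are the two arrows. -/
def arrows : M.V₂ →ₗ[k] M.V₁ × M.V₁ := M.α.prod M.β

variable (M) in
/-- The reflection of `M` at the source `2`, relabelled so that the arrows again go from `2` to `1`:
the vertex `1` of the new module carries the cokernel of `V₂ → V₁ × V₁`, the vertex `2` carries
`V₁`, and the arrows are the two components of the projection. -/
def reflect : KroneckerModule.{u, v} k where
  V₁ := (M.V₁ × M.V₁) ⧸ LinearMap.range M.arrows
  V₂ := M.V₁
  α := (LinearMap.range M.arrows).mkQ ∘ₗ LinearMap.inl k M.V₁ M.V₁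
  β := (LinearMap.range M.arrows).mkQ ∘ₗ LinearMap.inr k M.V₁ M.V₁

variable (M) in
lemma gen_reflect (U : Submodule k M.V₁) :
    M.reflect.gen U = (U.prod U).map (LinearMap.range M.arrows).mkQ := by
  have h : U.prod U = U.map (LinearMap.inl k M.V₁ M.V₁) ⊔ U.map (LinearMap.inr k M.V₁ M.V₁) := by
    rw [Submodule.map_inl, Submodule.map_inr, Submodule.prod_sup_prod, sup_bot_eq, bot_sup_eq]
  rw [h, Submodule.map_sup, ← Submodule.map_comp, ← Submodule.map_comp]
  rfl

lemma finrank_cogen_add_finrank_gen_reflect (hM : Function.Injective M.arrows)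
    (U : Submodule k M.V₁) :
    finrank k (M.cogen U) + finrank k (M.reflect.gen U) = 2 * finrank k U := by
  have h1 : M.cogen U = (U.prod U).comap M.arrows := by ext; simp [cogen, arrows]
  have h2 : finrank k (U.prod U) = 2 * finrank k U := by
    let e : U.prod U ≃ₗ[k] U × U :=
      { toFun := fun x => (⟨x.1.1, x.2.1⟩, ⟨x.1.2, x.2.2⟩)
        invFun := fun x => ⟨(x.1, x.2), x.1.2, x.2.2⟩
        map_add' := fun _ _ => rfl
        map_smul' := fun _ _ => rfl }
    rw [e.finrank_eq, finrank_prod, two_mul]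
  have h3 := finrank_map_add_finrank_ker_inf (LinearMap.range M.arrows).mkQ (U.prod U)
  have h4 := finrank_map_add_finrank_ker_inf M.arrows (M.cogen U)
  rw [LinearMap.ker_eq_bot.2 hM, bot_inf_eq, finrank_bot, add_zero, h1,
    Submodule.map_comap_eq] at h4
  rw [Submodule.ker_mkQ, h4, h2, ← gen_reflect, ← h1] at h3
  exact (add_comm _ _).trans h3

lemma Indecomposable.eq_bot_or_eq_bot (hM : M.Indecomposable) {N N' : M.Sub}
    (h : M.IsDirectSum N N') : N.U₁ = ⊥ ∧ N.U₂ = ⊥ ∨ N'.U₁ = ⊥ ∧ N'.U₂ = ⊥ := by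
  simpa only [Sub.isZero_toModule_iff] using hM.2 N N' h

/-- A complement of the image of `V₂` splits off as a multiple of the simple projective module. -/
lemma Indecomposable.gen_top (hM : M.Indecomposable) [Nontrivial M.V₂] : M.gen ⊤ = ⊤ := by
  obtain ⟨C, hC⟩ := Submodule.exists_isCompl (M.gen ⊤)
  have hg := gen_le_iff.1 (le_refl (M.gen ⊤))
  rcases hM.eq_bot_or_eq_bot (N := ⟨M.gen ⊤, ⊤, hg.1, hg.2⟩) (N' := ⟨C, ⊥, by simp, by simp⟩)
    ⟨hC, isCompl_top_bot⟩ with h | h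
  · exact absurd h.2 top_ne_bot
  · exact eq_top_of_isCompl_bot (h.1 ▸ hC)

/-- The common kernel of the two arrows splits off as a multiple of the simple injective module. -/
lemma Indecomposable.arrows_injective (hM : M.Indecomposable) [Nontrivial M.V₁] :
    Function.Injective M.arrows := by
  obtain ⟨C, hC⟩ := Submodule.exists_isCompl (LinearMap.ker M.arrows)
  have hk : ∀ x ∈ LinearMap.ker M.arrows, M.α x = 0 ∧ M.β x = 0 := fun x hx =>
    Prod.mk_eq_zero.1 (LinearMap.mem_ker.1 hx)
  rcases hM.eq_bot_or_eq_bot (N := ⟨⊤, C, by simp, by simp⟩)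
    (N' := ⟨⊥, LinearMap.ker M.arrows, fun x hx => (hk x hx).1, fun x hx => (hk x hx).2⟩)
    ⟨isCompl_top_bot, hC.symm⟩ with h | h
  · exact absurd h.1 top_ne_bot
  · exact LinearMap.ker_eq_bot.1 h.2

/-- A decomposition of the reflection induces one of `M`, whose summands are the submodules
cogenerated by the two subspaces of `V₁`. The statement is phrased without `reflect`, in terms of
subspaces of `V₁` and of the cokernel of `V₂ → V₁ × V₁`. -/
lemma Indecomposable.eq_bot_of_cokernel (hM : M.Indecomposable) [Nontrivial M.V₁]
    {A B : Submodule k M.V₁} {A₀ B₀ : Submodule k ((M.V₁ × M.V₁) ⧸ LinearMap.range M.arrows)}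
    (h₁ : IsCompl A B) (h₀ : IsCompl A₀ B₀)
    (hA : (A.prod A).map (LinearMap.range M.arrows).mkQ ≤ A₀)
    (hB : (B.prod B).map (LinearMap.range M.arrows).mkQ ≤ B₀) :
    A₀ = ⊥ ∧ A = ⊥ ∨ B₀ = ⊥ ∧ B = ⊥ := by
  have hinj := hM.arrows_injective
  have hgen : (A.prod A).map (LinearMap.range M.arrows).mkQ ⊔
      (B.prod B).map (LinearMap.range M.arrows).mkQ = ⊤ := by
    rw [← Submodule.map_sup, Submodule.prod_sup_prod, h₁.sup_eq_top, Submodule.prod_top,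
      Submodule.map_top, Submodule.range_mkQ]
  have hdisj : Disjoint (M.cogen A) (M.cogen B) := by
    rw [Submodule.disjoint_def]
    intro x hx hx'
    refine hinj ?_
    rw [map_zero]
    exact Prod.ext (Submodule.disjoint_def.1 h₁.disjoint _ hx.1 hx'.1)
      (Submodule.disjoint_def.1 h₁.disjoint _ hx.2 hx'.2)
  have hcod : Codisjoint (M.cogen A) (M.cogen B) := by
    rw [codisjoint_iff, eq_top_iff]
    intro x _
    have htop := codisjoint_iff.1 h₁.codisjoint
    obtain ⟨a, ha, b, hb, hab⟩ := Submodule.mem_sup.1 (htop.ge (Submodule.mem_top (x := M.α x)))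
    obtain ⟨a', ha', b', hb', hab'⟩ := Submodule.mem_sup.1 (htop.ge (Submodule.mem_top (x := M.β x)))
    let π := (LinearMap.range M.arrows).mkQ
    have hsum : π (a, a') + π (b, b') = 0 := by
      rw [← map_add, Prod.mk_add_mk, hab, hab']
      exact (Submodule.Quotient.mk_eq_zero _).2 ⟨x, rfl⟩
    have hπa : π (a, a') ∈ A₀ := hA ⟨_, ⟨ha, ha'⟩, rfl⟩
    have hπb : π (b, b') ∈ B₀ := hB ⟨_, ⟨hb, hb'⟩, rfl⟩
    have hza : π (a, a') = 0 := Submodule.disjoint_def.1 h₀.disjoint _ hπa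
      (by rw [eq_neg_of_add_eq_zero_left hsum]; exact B₀.neg_mem hπb)
    have hzb : π (b, b') = 0 := by rwa [hza, zero_add] at hsum
    obtain ⟨y, hy⟩ := (Submodule.Quotient.mk_eq_zero _).1 hza
    obtain ⟨z, hz⟩ := (Submodule.Quotient.mk_eq_zero _).1 hzb
    have hxyz : x = y + z := hinj (by
      rw [map_add, hy, hz, Prod.mk_add_mk, hab, hab']; rfl)
    rw [hxyz]
    obtain ⟨rfl, rfl⟩ : M.α y = a ∧ M.β y = a' := Prod.mk.inj hy
    obtain ⟨rfl, rfl⟩ : M.α z = b ∧ M.β z = b' := Prod.mk.inj hz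
    exact Submodule.add_mem_sup ⟨ha, ha'⟩ ⟨hb, hb'⟩
  have hAc := le_cogen_iff.1 (le_refl (M.cogen A))
  have hBc := le_cogen_iff.1 (le_refl (M.cogen B))
  rcases hM.eq_bot_or_eq_bot (N := ⟨A, M.cogen A, hAc.1, hAc.2⟩)
    (N' := ⟨B, M.cogen B, hBc.1, hBc.2⟩) ⟨h₁, hdisj, hcod⟩ with ⟨h, -⟩ | ⟨h, -⟩
  · refine Or.inl ⟨?_, h⟩
    subst h
    rw [Submodule.prod_bot, Submodule.map_bot, bot_sup_eq] at hgen
    exact eq_bot_of_isCompl_top ((top_le_iff.1 (hgen ▸ hB)) ▸ h₀)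
  · refine Or.inr ⟨?_, h⟩
    subst h
    rw [Submodule.prod_bot, Submodule.map_bot, sup_bot_eq] at hgen
    exact eq_bot_of_isCompl_top ((top_le_iff.1 (hgen ▸ hA)) ▸ h₀.symm)

lemma Indecomposable.reflect (hM : M.Indecomposable) [Nontrivial M.V₁] :
    M.reflect.Indecomposable := by
  refine ⟨fun h => not_subsingleton M.V₁ h.2, fun N N' h => ?_⟩
  rw [Sub.isZero_toModule_iff, Sub.isZero_toModule_iff]
  refine hM.eq_bot_of_cokernel h.2 h.1 ?_ ?_
  · exact (gen_reflect M N.U₂).ge.trans (gen_le_iff.2 ⟨N.α_mem, N.β_mem⟩)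
  · exact (gen_reflect M N'.U₂).ge.trans (gen_le_iff.2 ⟨N'.α_mem, N'.β_mem⟩)

lemma finrank_reflect (hM : Function.Injective M.arrows) :
    finrank k M.reflect.V₁ + finrank k M.V₂ = 2 * finrank k M.V₁ := by
  have h := Submodule.finrank_quotient_add_finrank (LinearMap.range M.arrows)
  rwa [LinearMap.finrank_range_of_inj hM, finrank_prod, ← two_mul] at h

end Reflection

/-! ### Counting submodules -/

section Counting

universe u v

variable {k : Type u} [Field k] (M : KroneckerModule.{u, v} k)

lemma ncard_Gr_natCast (a b : ℕ) :
    (M.Gr a b).ncard = Nat.card {N : M.Sub // finrank k N.U₁ = a ∧ finrank k N.U₂ = b} := by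
  rw [← Nat.card_coe_set_eq]
  refine Nat.card_congr (Equiv.subtypeEquivRight fun N => ?_)
  simp only [Gr, HasDimVector, Set.mem_ofPred_eq, Nat.cast_inj]
  rfl

variable [Finite k]

instance : Finite M.V₁ := Module.finite_of_finite k
instance : Finite M.V₂ := Module.finite_of_finite k

/-- Submodules counted by their component at the vertex `1`. -/
lemma natCard_sub_eq_sum_cogen (a b : ℕ) [Fintype {U : Submodule k M.V₁ // finrank k U = a}] :
    (Nat.card {N : M.Sub // finrank k N.U₁ = a ∧ finrank k N.U₂ = b} : ℚ) =
      ∑ U : {U : Submodule k M.V₁ // finrank k U = a},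
        qBinom (Nat.card k) (finrank k (M.cogen U)) b := by
  simp_rw [← natCard_submodule_le_finrank_eq]
  rw [← Nat.cast_sum, ← Nat.card_sigma, Nat.cast_inj]
  exact Nat.card_congr
    { toFun := fun N => ⟨⟨N.1.U₁, N.2.1⟩, N.1.U₂, le_cogen_iff.2 ⟨N.1.α_mem, N.1.β_mem⟩, N.2.2⟩
      invFun := fun P => ⟨⟨P.1.1, P.2.1, (le_cogen_iff.1 P.2.2.1).1, (le_cogen_iff.1 P.2.2.1).2⟩,
        P.1.2, P.2.2.2⟩ }

/-- Submodules counted by their component at the vertex `2`. -/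
lemma natCard_sub_eq_sum_gen {a : ℕ} (b : ℕ) [Fintype {U : Submodule k M.V₂ // finrank k U = b}]
    (ha : a ≤ finrank k M.V₁) :
    (Nat.card {N : M.Sub // finrank k N.U₁ = a ∧ finrank k N.U₂ = b} : ℚ) =
      ∑ U : {U : Submodule k M.V₂ // finrank k U = b},
        qBinom (Nat.card k) (finrank k M.V₁ - finrank k (M.gen U)) (finrank k M.V₁ - a) := by
  simp_rw [← natCard_le_submodule_finrank_eq _ ha]
  rw [← Nat.cast_sum, ← Nat.card_sigma, Nat.cast_inj]
  exact Nat.card_congr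
    { toFun := fun N => ⟨⟨N.1.U₂, N.2.2⟩, N.1.U₁, gen_le_iff.2 ⟨N.1.α_mem, N.1.β_mem⟩, N.2.1⟩
      invFun := fun P => ⟨⟨P.2.1, P.1.1, (gen_le_iff.1 P.2.2.1).1, (gen_le_iff.1 P.2.2.1).2⟩,
        P.2.2.2, P.1.2⟩ }

end Counting
end KroneckerModule

/-! ### Inverting the moments of the codimension -/

section Recursion

variable {q : ℚ}

variable (q) in
lemma sum_qBinom_mul_qBinom_of_le {r R : ℕ} (hR : r ≤ R) (m d : ℕ) :
    ∑ j ∈ Finset.range (R + 1), q ^ (j * (j + d)) * qBinom q r j * qBinom q m (j + d) =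
      qBinom q (r + m) (r + d) := by
  rw [← sum_qBinom_mul_qBinom]
  refine (Finset.sum_subset (Finset.range_mono (by omega)) fun j _ hj => ?_).symm
  rw [qBinom_eq_zero q (by simpa [Nat.lt_succ_iff] using hj), mul_zero, zero_mul]

/-- If the moments of a family of numbers `e i ≤ m` with respect to the functions
`e ↦ [e choose f]` are `[m - u choose f] [m - f + 1 choose u]`, then the value `m - u - j` occurs
`q ^ (j (j + 1)) [m - u choose j] [u + 1 choose j + 1]` times. -/
lemma sum_comp_eq_of_sum_qBinom (hq : 1 < q) {ι : Type*} [Fintype ι] (e : ι → ℕ) {m u : ℕ}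
    (hu : u ≤ m) (he : ∀ i, e i ≤ m)
    (h : ∀ f ≤ m, ∑ i, qBinom q (e i) f = qBinom q (m - u) f * qBinom q (m - f + 1) u)
    (g : ℕ → ℚ) :
    ∑ i, g (e i) = ∑ j ∈ Finset.range (m - u + 1),
      q ^ (j * (j + 1)) * qBinom q (m - u) j * qBinom q (u + 1) (j + 1) * g (m - u - j) := by
  have hmoment : ∀ f ≤ m, ∑ j ∈ Finset.range (m - u + 1), q ^ (j * (j + 1)) *
      qBinom q (m - u) j * qBinom q (u + 1) (j + 1) * qBinom q (m - u - j) f =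
      qBinom q (m - u) f * qBinom q (m - f + 1) u := by
    intro f hf
    have hrev : ∀ j, q ^ (j * (j + 1)) * qBinom q (m - u) j * qBinom q (u + 1) (j + 1) *
        qBinom q (m - u - j) f = qBinom q (m - u) f *
          (q ^ (j * (j + 1)) * qBinom q (m - u - f) j * qBinom q (u + 1) (j + 1)) := fun j => by
      linear_combination q ^ (j * (j + 1)) * qBinom q (u + 1) (j + 1) *
        qBinom_mul_qBinom_sub hq (m - u) j f
    simp_rw [hrev]
    rw [← Finset.mul_sum, sum_qBinom_mul_qBinom_of_le q (by omega)]
    by_cases hfu : f ≤ m - u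
    · have hsymm := qBinom_symm_add hq (m - u - f + 1) u
      rw [show m - u - f + 1 + u = m - f + 1 by omega] at hsymm
      rw [show m - u - f + (u + 1) = m - f + 1 by omega, hsymm]
    · rw [qBinom_eq_zero q (not_le.1 hfu), zero_mul, zero_mul]
  obtain ⟨c, hc⟩ := exists_eq_sum_qBinom q g m
  have hl : ∑ i, g (e i) = ∑ f ∈ Finset.range (m + 1), c f * ∑ i, qBinom q (e i) f := by
    rw [Finset.sum_congr rfl fun i _ => hc _ (he i), Finset.sum_comm]
    simp_rw [Finset.mul_sum]
  have hr : ∑ j ∈ Finset.range (m - u + 1), q ^ (j * (j + 1)) * qBinom q (m - u) j *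
      qBinom q (u + 1) (j + 1) * g (m - u - j) = ∑ f ∈ Finset.range (m + 1), c f *
        ∑ j ∈ Finset.range (m - u + 1), q ^ (j * (j + 1)) * qBinom q (m - u) j *
          qBinom q (u + 1) (j + 1) * qBinom q (m - u - j) f := by
    simp_rw [hc (m - u - _) ((Nat.sub_le _ _).trans (Nat.sub_le _ _)), Finset.mul_sum]
    rw [Finset.sum_comm]
    exact Finset.sum_congr rfl fun f _ => Finset.sum_congr rfl fun j _ => by ring
  rw [hl, hr]
  refine Finset.sum_congr rfl fun f hf => ?_
  have hf : f ≤ m := Nat.lt_succ_iff.1 (Finset.mem_range.1 hf)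
  rw [h f hf, hmoment f hf]

/-- The sum of `[2 u + e - m choose b]` over the distribution of `e = m - u - j` found in
`sum_comp_eq_of_sum_qBinom`. -/
lemma sum_mul_qBinom_eq (hq : 1 < q) {m u : ℕ} (hu : u ≤ m) (b : ℕ) :
    ∑ j ∈ Finset.range (m - u + 1), q ^ (j * (j + 1)) * qBinom q (m - u) j *
        qBinom q (u + 1) (j + 1) * qBinom q (2 * u + (m - u - j) - m) b =
      qBinom q (m + 1 - b) (m + 1 - u) * qBinom q (u + 1) b := by
  have hrev : ∀ j ∈ Finset.range (m - u + 1), q ^ (j * (j + 1)) * qBinom q (m - u) j *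
      qBinom q (u + 1) (j + 1) * qBinom q (2 * u + (m - u - j) - m) b =
      qBinom q (u + 1) b *
        (q ^ (j * (j + 1)) * qBinom q (m - u) j * qBinom q (u + 1 - b) (j + 1)) := fun j hj => by
    rw [Finset.mem_range] at hj
    -- For `j > u` both truncated differences are `0`.
    rw [show 2 * u + (m - u - j) - m = u + 1 - (j + 1) by omega]
    linear_combination q ^ (j * (j + 1)) * qBinom q (m - u) j *
      qBinom_mul_qBinom_sub hq (u + 1) (j + 1) b
  rw [Finset.sum_congr rfl hrev, ← Finset.mul_sum, sum_qBinom_mul_qBinom]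
  by_cases hb : b ≤ u + 1
  · rw [show m - u + (u + 1 - b) = m + 1 - b by omega, show m - u + 1 = m + 1 - u by omega,
      mul_comm]
  · rw [qBinom_eq_zero q (not_le.1 hb), zero_mul, mul_zero]

end Recursion

/-! ### The count for the preinjective modules -/

namespace KroneckerModule

open Module

section Main

universe u v

variable {k : Type u} [Field k] [Finite k]

/-- Submodules of the reflection counted by their component at the vertex `2`, a subspace `U` of
`V₁`. The codimension of the subspace that `U` generates is expressed through the dimension of
`M.cogen U`. -/
lemma natCard_sub_reflect_eq_sum {M : KroneckerModule.{u, v} k} (hM : Function.Injective M.arrows)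
    {a : ℕ} (b : ℕ) [Fintype {U : Submodule k M.V₁ // finrank k U = b}]
    (ha : a ≤ finrank k M.reflect.V₁) :
    (Nat.card {N : M.reflect.Sub // finrank k N.U₁ = a ∧ finrank k N.U₂ = b} : ℚ) =
      ∑ U : {U : Submodule k M.V₁ // finrank k U = b},
        qBinom (Nat.card k) (finrank k M.reflect.V₁ + finrank k (M.cogen U) - 2 * b)
          (finrank k M.reflect.V₁ - a) := by
  let _ : Fintype {U : Submodule k M.reflect.V₂ // finrank k U = b} :=
    ‹Fintype {U : Submodule k M.V₁ // finrank k U = b}›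
  refine (natCard_sub_eq_sum_gen M.reflect (a := a) b ha).trans
    (Finset.sum_congr rfl fun U _ => ?_)
  have h : finrank k (M.cogen U.1) + finrank k (M.reflect.gen U.1) = 2 * b :=
    (finrank_cogen_add_finrank_gen_reflect hM U.1).trans (congrArg (2 * ·) U.2)
  have h' : finrank k (M.reflect.gen U.1) ≤ finrank k M.reflect.V₁ := Submodule.finrank_le _
  congr 1
  omega

/-- The symmetric form `[n - b choose n - a]` of `[n - b choose a - b]` makes the formula valid,
as `0 = 0`, also for `a < b ≤ n`. -/
theorem Indecomposable.natCard_sub {n : ℕ} {M : KroneckerModule.{u, v} k} (hM : M.Indecomposable)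
    (h₁ : finrank k M.V₁ = n) (h₂ : finrank k M.V₂ = n + 1) {a b : ℕ} (ha : a ≤ n) (hb : b ≤ n) :
    (Nat.card {N : M.Sub // finrank k N.U₁ = a ∧ finrank k N.U₂ = b} : ℚ) =
      qBinom (Nat.card k) (n - b) (n - a) * qBinom (Nat.card k) (a + 1) b := by
  have hq := one_lt_natCard_cast k
  induction n generalizing M a b with
  | zero =>
    obtain ⟨rfl, rfl⟩ : a = 0 ∧ b = 0 := by omega
    have := Fintype.ofFinite {U : Submodule k M.V₁ // finrank k U = 0}
    rw [natCard_sub_eq_sum_cogen]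
    simp only [qBinom_zero_right, Finset.sum_const, Finset.card_univ, nsmul_eq_mul, mul_one]
    rw [← Nat.card_eq_fintype_card, natCard_submodule_finrank_eq, qBinom_zero_right,
      Nat.sub_self, qBinom_zero_right]
  | succ m ih =>
    have : Nontrivial M.V₁ := Module.nontrivial_of_finrank_pos (R := k) (by omega)
    have := Fintype.ofFinite {U : Submodule k M.V₁ // finrank k U = a}
    have hinj := hM.arrows_injective
    have hr : finrank k M.reflect.V₁ = m := by have := finrank_reflect hinj; omega
    rw [natCard_sub_eq_sum_cogen]
    rcases ha.eq_or_lt with rfl | ha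
    -- For `a = m + 1` the only choice is `U = V₁`, with `M.cogen U = V₂`; the induction
    -- hypothesis does not cover it.
    · have htop : ∀ U : {U : Submodule k M.V₁ // finrank k U = m + 1},
          finrank k (M.cogen U) = m + 1 + 1 := fun U => by
        rw [← h₂, ← finrank_top k M.V₂,
          Submodule.eq_top_of_finrank_eq (U.2.trans h₁.symm), cogen, Submodule.comap_top,
          Submodule.comap_top, inf_top_eq]
      simp only [htop, Finset.sum_const, Finset.card_univ, nsmul_eq_mul]
      rw [← Nat.card_eq_fintype_card, natCard_submodule_finrank_eq, h₁, qBinom_self, Nat.sub_self,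
        qBinom_zero_right]
    · have ha : a ≤ m := Nat.lt_succ_iff.1 ha
      have hdim : ∀ U : {U : Submodule k M.V₁ // finrank k U = a},
          finrank k (M.cogen U) ≤ 2 * a ∧ 2 * a ≤ m + finrank k (M.cogen U) := fun U => by
        have h := finrank_cogen_add_finrank_gen_reflect hinj U.1
        rw [U.2] at h
        have h' : finrank k (M.reflect.gen U.1) ≤ finrank k M.reflect.V₁ := Submodule.finrank_le _
        omega
      rw [← sum_mul_qBinom_eq hq ha b, ← sum_comp_eq_of_sum_qBinom hq
        (fun U : {U : Submodule k M.V₁ // finrank k U = a} => m + finrank k (M.cogen U) - 2 * a)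
        ha (fun U => by have := hdim U; omega) ?_
        (fun e => qBinom (Nat.card k) (2 * a + e - m) b)]
      · refine Finset.sum_congr rfl fun U _ => ?_
        have := hdim U
        congr 1
        omega
      · intro f hf
        have h := ih hM.reflect hr h₁ (a := m - f) (b := a) (by omega) ha
        rw [natCard_sub_reflect_eq_sum hinj a (by omega), hr, Nat.sub_sub_self hf] at h
        exact h

end Main

end KroneckerModule

open Module KroneckerModule in
/-- `I` is the indecomposable (preinjective) Kronecker module of dimension vector `(n, n + 1)`,
which is unique up to isomorphism. -/
theorem theorem4p3 {k : Type*} [Field k] [Finite k] (n : ℕ) (I : KroneckerModule k)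
    (hI : I.Indecomposable) (hdim : I.HasDimVector n (n + 1)) (a b : ℤ) :
    ((I.Gr a b).ncard : ℚ) =
      if a > n ∨ b > n + 1 then 0
      else if a = n ∧ b = n + 1 then 1
      else gaussCoeff (a - b) (n - b) (Nat.card k) * gaussCoeff b (a + 1) (Nat.card k) := by
  have hq := one_lt_natCard_cast k
  have h₁ : finrank k I.V₁ = n := by exact_mod_cast hdim.1
  have h₂ : finrank k I.V₂ = n + 1 := by exact_mod_cast hdim.2
  have : Nontrivial I.V₂ := Module.nontrivial_of_finrank_pos (R := k) (by omega)
  have hneg : ∀ l c : ℤ, l < 0 → gaussCoeff l c (Nat.card k) = 0 := fun l c hl => if_pos hl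
  have hempty : (∀ N : I.Sub, (finrank k N.U₁ : ℤ) = a → (finrank k N.U₂ : ℤ) = b → False) →
      ((I.Gr a b).ncard : ℚ) = 0 := fun h => by
    rw [Set.eq_empty_of_forall_notMem (s := I.Gr a b) fun N hN => h N hN.1 hN.2,
      Set.ncard_empty, Nat.cast_zero]
  have hle : ∀ N : I.Sub, finrank k N.U₁ ≤ n ∧ finrank k N.U₂ ≤ n + 1 := fun N =>
    ⟨h₁ ▸ N.U₁.finrank_le, h₂ ▸ N.U₂.finrank_le⟩
  have hfull : ∀ N : I.Sub, finrank k N.U₂ = n + 1 → N.U₁ = ⊤ ∧ N.U₂ = ⊤ := fun N hN => by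
    have htop : N.U₂ = ⊤ := Submodule.eq_top_of_finrank_eq (hN.trans h₂.symm)
    refine ⟨top_le_iff.1 (hI.gen_top ▸ gen_le_iff.2 ⟨?_, ?_⟩), htop⟩
    · exact fun x _ => N.α_mem x (htop ▸ Submodule.mem_top)
    · exact fun x _ => N.β_mem x (htop ▸ Submodule.mem_top)
  split_ifs with hbig htop
  · exact hempty fun N _ _ => by have := hle N; omega
  · obtain ⟨rfl, rfl⟩ := htop
    have hone : I.Gr n (n + 1) = {⟨⊤, ⊤, by simp, by simp⟩} := by
      ext ⟨U₁, U₂, hα, hβ⟩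
      rw [Set.mem_singleton_iff, Sub.mk.injEq]
      refine ⟨fun hN => hfull ⟨U₁, U₂, hα, hβ⟩ ?_, ?_⟩
      · exact_mod_cast hN.2
      · rintro ⟨rfl, rfl⟩
        refine ⟨?_, ?_⟩
        · exact_mod_cast (finrank_top k I.V₁).trans h₁
        · exact_mod_cast (finrank_top k I.V₂).trans h₂
    rw [hone, Set.ncard_singleton, Nat.cast_one]
  · push Not at hbig
    by_cases hb : b < 0
    · rw [hneg b _ hb, mul_zero]
      exact hempty fun N _ _ => by omega
    by_cases ha : a < 0
    · rw [hneg (a - b) _ (by omega), zero_mul]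
      exact hempty fun N _ _ => by omega
    by_cases hbn : b = n + 1
    · rw [hneg (a - b) _ (by omega), zero_mul]
      refine hempty fun N hN hN' => htop ⟨?_, hbn⟩
      rw [← hN, (hfull N (by omega)).1, finrank_top, h₁]
    lift a to ℕ using not_lt.1 ha
    lift b to ℕ using not_lt.1 hb
    rw [ncard_Gr_natCast, hI.natCard_sub h₁ h₂ (by omega) (by omega),
      show (a : ℤ) + 1 = ((a + 1 : ℕ) : ℤ) by push_cast; rfl, gaussCoeff_natCast hq]
    by_cases hab : b ≤ a
    · obtain ⟨c, rfl⟩ := Nat.exists_eq_add_of_le hab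
      obtain ⟨d, rfl⟩ := Nat.exists_eq_add_of_le (show b + c ≤ n by omega)
      rw [show ((b + c : ℕ) : ℤ) - b = (c : ℕ) by push_cast; ring,
        show ((b + c + d : ℕ) : ℤ) - b = ((c + d : ℕ) : ℤ) by push_cast; ring,
        gaussCoeff_natCast hq, show b + c + d - b = c + d by omega,
        show b + c + d - (b + c) = d by omega, qBinom_symm_add hq]
    · rw [hneg _ _ (by omega), qBinom_eq_zero _ (show n - b < n - a by omega)]
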